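/- Let $\mathbb{F}$ be a field of characteristic different from $2$ that is either quadratically closed (every element of $\mathbb{F}$ is a square) or equal to $\mathbb{R}$. Endow $M_2(\mathbb{F})$ with the symplectic involution $$\begin{pmatrix} a & b\\ c& d\end{pmatrix}^{s}=\begin{pmatrix} d & -b\\ -c& a\end{pmatrix},$$ and let $M_2(\mathbb{F})^{+}=\{A : A^{s}=A\}$ and $M_2(\mathbb{F})^{-}=\{A : A^{s}=-A\}$ be the spaces of symmetric and skew-symmetric elements. Let $k,l\ge 0$ be integers with $k+l\ge 1$, and let $f(y_1,\dots,y_k,z_1,\dots,z_l)$ be a multilinear $*$-polynomial over $\mathbb{F}$ in symmetric variables $y_1,\dots,y_k$ and skew-symmetric variables $z_1,\dots,z_l$, that is, an element of the free associative $\mathbb{F}$-algebra on $y_1,\dots,y_k,z_1,\dots,z_l$ in each monomial of which every one of these $k+l$ variables occurs exactly once. Then the image of $f$ on $M_2(\mathbb{F})$, $$\{\, f(a_1,\dots,a_k,b_1,\dots,b_l) : a_i\in M_2(\mathbb{F})^{+},\ b_j\in M_2(\mathbb{F})^{-} \,\},$$ is one of $\{0\}$, $\mathbb{F}$ (the scalar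 matrices), $sl_2(\mathbb{F})$ (the matrices of trace zero) or $M_2(\mathbb{F})$. -/

import Mathlib

namespace StarPoly

/-- A field is quadratically closed if each of its elements is a square. (Away from
characteristic two this says that every polynomial of degree two has a root.) -/
def IsQuadraticallyClosed (F : Type*) [Field F] : Prop :=
  ∀ a : F, IsSquare a

/-- An involution of the first kind on an `F`-algebra `A`: an `F`-linear map `*` with
`(a*)* = a` and `(ab)* = b* a*`. -/
structure Involution (F A : Type*) [Field F] [Ring A] [Algebra F A] where
  toLin : A →ₗ[F] A
  invol : ∀ a, toLin (toLin a) = a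
  antimul : ∀ a b, toLin (a * b) = toLin b * toLin a

namespace Involution

variable {F A : Type*} [Field F] [Ring A] [Algebra F A]

/-- The space of symmetric elements, `a* = a`. -/
def symm (s : Involution F A) : Submodule F A where
  carrier := {a | s.toLin a = a}
  add_mem' := by
    intro a b ha hb
    simp only [Set.mem_ofPred_eq] at *
    rw [map_add, ha, hb]
  zero_mem' := map_zero _
  smul_mem' := by
    intro c a ha
    simp only [Set.mem_ofPred_eq] at *
    rw [map_smul, ha]

/-- The space of skew-symmetric elements, `a* = -a`. -/
def skew (s : Involution F A) : Submodule F A where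
  carrier := {a | s.toLin a = -a}
  add_mem' := by
    intro a b ha hb
    simp only [Set.mem_ofPred_eq] at *
    rw [map_add, ha, hb, neg_add]
  zero_mem' := by simp
  smul_mem' := by
    intro c a ha
    simp only [Set.mem_ofPred_eq] at *
    rw [map_smul, ha, smul_neg]

end Involution

/-- The symplectic involution on `2 × 2` matrices, sending the matrix with rows
`(a, b)`, `(c, d)` to the matrix with rows `(d, -b)`, `(-c, a)`. -/
def symplectic (F : Type*) [Field F] : Involution F (Matrix (Fin 2) (Fin 2) F) where
  toLin :=
    { toFun := fun M => !![M 1 1, -M 0 1; -M 1 0, M 0 0]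
      map_add' := by
        intro M N
        ext i j
        fin_cases i <;> fin_cases j <;> simp [add_comm]
      map_smul' := by
        intro c M
        ext i j
        fin_cases i <;> fin_cases j <;> simp }
  invol := by
    intro M
    ext i j
    fin_cases i <;> fin_cases j <;> simp
  antimul := by
    intro M N
    ext i j
    fin_cases i <;> fin_cases j <;> simp [Matrix.mul_apply, Fin.sum_univ_two] <;> ring

/-- The `*`-polynomials in the symmetric variables `y₁, …, y_k` and the skew-symmetric
variables `z₁, …, z_l`: the free associative algebra on these `k + l` letters. -/
abbrev Polynomials (F : Type*) [Field F] (k l : ℕ) : Type _ :=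
  FreeAlgebra F (Fin k ⊕ Fin l)

/-- A `*`-polynomial is multilinear if each of the variables `y₁, …, y_k, z₁, …, z_l`
occurs exactly once in each of its monomials (words with a nonzero coefficient). -/
def IsMultilinear {F : Type*} [Field F] {k l : ℕ} (f : Polynomials F k l) : Prop :=
  ∀ w ∈ (FreeAlgebra.equivMonoidAlgebraFreeMonoid f :
      MonoidAlgebra F (FreeMonoid (Fin k ⊕ Fin l))).coeff.support,
    ∀ v : Fin k ⊕ Fin l, (FreeMonoid.toList w).count v = 1

/-- The image of the map `(A⁺)ᵏ × (A⁻)ˡ → A` that `f` defines by evaluation. -/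
def image {F A : Type*} [Field F] [Ring A] [Algebra F A] (s : Involution F A) {k l : ℕ}
    (f : Polynomials F k l) : Set A :=
  Set.range fun p : (Fin k → s.symm) × (Fin l → s.skew) =>
    FreeAlgebra.lift F (Sum.elim (fun i => (p.1 i : A)) (fun j => (p.2 j : A))) f

end StarPoly

/-!
For the symplectic involution the symmetric elements of `M₂(F)` are the scalars and the
skew-symmetric ones are the matrices of trace zero. Projecting every argument to one of these
spaces turns a multilinear `*`-polynomial into a multilinear map `G` on all of `M₂(F)`, with the
same image, that commutes with simultaneous conjugation. The proof uses nothing else about the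
polynomial: the image of any equivariant multilinear map is `0`, `F`, `sl₂(F)` or `M₂(F)`
(`IsConjEquivariant.range_eq`).

The image is closed under scaling and under conjugation, and matrices that are not scalar are
conjugate if they have the same trace and determinant. So it suffices to realize invariants. On
tuples of quaternion units `1, h, j, k` the values of `G` are multiples of quaternion units, since
these units span the components of a grading by the Klein four group, which acts by conjugation.
On tuples of matrix units the values are homogeneous for the diagonal torus. If `G` has a value
that is not scalar, then, because conjugation mixes the components, nonzero multiples of `h`, of
`k` and of `E₁₂` all occur as values. This gives every matrix of trace zero
(`IsConjEquivariant.mem_range_of_trace_eq_zero`). If some trace is nonzero, multiples of `1` occur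
as well.

In the last case it remains to find, for each `c`, a value that is not scalar, has nonzero trace,
and satisfies `tr² - 4 det = c tr²`. Over a quadratically closed field, two unit tuples of
different vector degree at minimal Hamming distance show that the discriminant, as a quadratic form
in a suitable single variable, has rank at least two
(`IsConjEquivariant.exists_polarDisc_sq_ne`); this persists at a point where the trace is nonzero,
and on a line of constant trace the discriminant is then a nonconstant polynomial of degree at most
two. Over the reals, the form `disc - c tr²` is positive at a multiple of `h` and negative at a
multiple of `k`. Along a path in general position that changes one variable at a time it changes
sign in a single step, and there it is an indefinite binary form with two isotropic lines, on at
least one of which the trace does not vanish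
(`IsConjEquivariant.exists_disc_eq_mul_trace_sq_of_real`).
-/

namespace StarPoly

/-! ### Conjugacy of `2 × 2` matrices -/

section Matrices

variable {F : Type*} [Field F]

/-- A `2 × 2` matrix is scalar if it is a multiple of the identity. -/
def IsScalarMatrix (A : Matrix (Fin 2) (Fin 2) F) : Prop :=
  A 0 1 = 0 ∧ A 1 0 = 0 ∧ A 0 0 = A 1 1

lemma isScalarMatrix_iff_mem_range (A : Matrix (Fin 2) (Fin 2) F) :
    IsScalarMatrix A ↔ A ∈ Set.range (algebraMap F (Matrix (Fin 2) (Fin 2) F)) := by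
  constructor
  · rintro ⟨h1, h2, h3⟩
    refine ⟨A 0 0, ?_⟩
    ext i j
    fin_cases i <;> fin_cases j <;> simp [Matrix.algebraMap_matrix_apply, h1, h2, h3]
  · rintro ⟨c, rfl⟩
    simp [IsScalarMatrix, Matrix.algebraMap_matrix_apply]

/-- The discriminant of the characteristic polynomial, `tr² - 4 det`. On trace zero matrices it is
four times the quadratic form `A ↦ A²`, and it ignores the scalar part of a matrix. -/
def disc (A : Matrix (Fin 2) (Fin 2) F) : F :=
  (A 0 0 - A 1 1) ^ 2 + 4 * (A 0 1 * A 1 0)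

/-- The symmetric bilinear form with `polarDisc A A = disc A`. -/
def polarDisc (A B : Matrix (Fin 2) (Fin 2) F) : F :=
  (A 0 0 - A 1 1) * (B 0 0 - B 1 1) + 2 * (A 0 1 * B 1 0 + A 1 0 * B 0 1)

lemma disc_eq_trace_sq_sub (A : Matrix (Fin 2) (Fin 2) F) :
    disc A = A.trace ^ 2 - 4 * A.det := by
  rw [disc, Matrix.trace_fin_two, Matrix.det_fin_two]
  ring

lemma disc_smul (c : F) (A : Matrix (Fin 2) (Fin 2) F) : disc (c • A) = c ^ 2 * disc A := by
  simp only [disc, Matrix.smul_apply, smul_eq_mul]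
  ring

lemma disc_add_smul (A B : Matrix (Fin 2) (Fin 2) F) (t : F) :
    disc (A + t • B) = disc A + 2 * t * polarDisc A B + t ^ 2 * disc B := by
  simp only [disc, polarDisc, Matrix.add_apply, Matrix.smul_apply, smul_eq_mul]
  ring

lemma polarDisc_self (A : Matrix (Fin 2) (Fin 2) F) : polarDisc A A = disc A := by
  rw [polarDisc, disc]
  ring

lemma polarDisc_comm (A B : Matrix (Fin 2) (Fin 2) F) : polarDisc A B = polarDisc B A := by
  rw [polarDisc, polarDisc]
  ring

lemma polarDisc_add_smul_left (A B C : Matrix (Fin 2) (Fin 2) F) (t : F) :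
    polarDisc (A + t • B) C = polarDisc A C + t * polarDisc B C := by
  simp only [polarDisc, Matrix.add_apply, Matrix.smul_apply, smul_eq_mul]
  ring

lemma IsScalarMatrix.disc_eq_zero {A : Matrix (Fin 2) (Fin 2) F} (h : IsScalarMatrix A) :
    disc A = 0 := by
  obtain ⟨h1, h2, h3⟩ := h
  simp [disc, h1, h3]

lemma IsScalarMatrix.polarDisc_eq_zero {A : Matrix (Fin 2) (Fin 2) F} (h : IsScalarMatrix A)
    (B : Matrix (Fin 2) (Fin 2) F) : polarDisc A B = 0 := by
  obtain ⟨h1, h2, h3⟩ := h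
  simp [polarDisc, h1, h2, h3]

lemma IsScalarMatrix.smul {A : Matrix (Fin 2) (Fin 2) F} (h : IsScalarMatrix A) (c : F) :
    IsScalarMatrix (c • A) := by
  obtain ⟨h1, h2, h3⟩ := h
  simp [IsScalarMatrix, h1, h2, h3]

lemma isScalarMatrix_smul_iff {A : Matrix (Fin 2) (Fin 2) F} {c : F} (hc : c ≠ 0) :
    IsScalarMatrix (c • A) ↔ IsScalarMatrix A := by
  refine ⟨fun h => ?_, fun h => h.smul c⟩
  simpa [smul_smul, hc] using h.smul c⁻¹

lemma IsScalarMatrix.eq_of_trace_eq (h2 : (2 : F) ≠ 0) {A B : Matrix (Fin 2) (Fin 2) F}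
    (hA : IsScalarMatrix A) (hB : IsScalarMatrix B) (h : A.trace = B.trace) : A = B := by
  obtain ⟨a1, a2, a3⟩ := hA
  obtain ⟨b1, b2, b3⟩ := hB
  rw [Matrix.trace_fin_two, Matrix.trace_fin_two] at h
  have h0 : A 0 0 = B 0 0 := mul_left_cancel₀ h2 (by linear_combination h + a3 - b3)
  ext i j
  fin_cases i <;> fin_cases j
  · exact h0
  · exact a1.trans b1.symm
  · exact a2.trans b2.symm
  · exact (a3.symm.trans h0).trans b3

/-- A matrix that is not scalar has a cyclic vector, so it is conjugate to its companion matrix. -/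
lemma exists_conj_companion {A : Matrix (Fin 2) (Fin 2) F} (hA : ¬ IsScalarMatrix A) :
    ∃ P Q : Matrix (Fin 2) (Fin 2) F, P * Q = 1 ∧
      A = P * !![0, -A.det; 1, A.trace] * Q := by
  -- It is enough to find `v` such that the matrix `P` with columns `v` and `A v` is invertible.
  have key : ∀ v : Fin 2 → F,
      v 0 * (A 1 0 * v 0 + A 1 1 * v 1) - (A 0 0 * v 0 + A 0 1 * v 1) * v 1 ≠ 0 →
      ∃ P Q : Matrix (Fin 2) (Fin 2) F, P * Q = 1 ∧
        A = P * !![0, -A.det; 1, A.trace] * Q := by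
    intro v hv
    set P : Matrix (Fin 2) (Fin 2) F :=
      !![v 0, A 0 0 * v 0 + A 0 1 * v 1; v 1, A 1 0 * v 0 + A 1 1 * v 1] with hP
    have hdet : IsUnit P.det := by
      rw [isUnit_iff_ne_zero, Matrix.det_fin_two]
      simpa [hP] using hv
    have hPQ : P * P⁻¹ = 1 := Matrix.mul_nonsing_inv P hdet
    have hAP : A * P = P * !![0, -A.det; 1, A.trace] := by
      rw [Matrix.det_fin_two, Matrix.trace_fin_two]
      ext i j
      fin_cases i <;> fin_cases j <;>
        simp [hP, Matrix.mul_apply, Fin.sum_univ_two] <;> ring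
    exact ⟨P, P⁻¹, hPQ, by rw [← hAP, Matrix.mul_assoc, hPQ, Matrix.mul_one]⟩
  by_cases h10 : A 1 0 = 0
  · by_cases h01 : A 0 1 = 0
    · refine key ![1, 1] ?_
      have : A 1 1 - A 0 0 ≠ 0 := fun h => hA ⟨h01, h10, (sub_eq_zero.mp h).symm⟩
      simpa [h10, h01] using this
    · exact key ![0, 1] (by simpa using h01)
  · exact key ![1, 0] (by simpa using h10)

lemma exists_conj_of_trace_eq_of_det_eq {A B : Matrix (Fin 2) (Fin 2) F}
    (hA : ¬ IsScalarMatrix A) (hB : ¬ IsScalarMatrix B) (ht : A.trace = B.trace)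
    (hd : A.det = B.det) :
    ∃ P Q : Matrix (Fin 2) (Fin 2) F, P * Q = 1 ∧ B = P * A * Q := by
  obtain ⟨P, Q, hPQ, hP⟩ := exists_conj_companion hA
  obtain ⟨R, S, hRS, hR⟩ := exists_conj_companion hB
  have hQP : Q * P = 1 := mul_eq_one_comm.mp hPQ
  refine ⟨R * Q, P * S, ?_, ?_⟩
  · calc R * Q * (P * S) = R * (Q * P) * S := by noncomm_ring
      _ = 1 := by rw [hQP, mul_one, hRS]
  · rw [ht, hd] at hP
    set C : Matrix (Fin 2) (Fin 2) F := !![0, -B.det; 1, B.trace] with hC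
    rw [hR, hP]
    calc R * C * S = R * (1 * C * 1) * S := by rw [one_mul, mul_one]
      _ = R * ((Q * P) * C * (Q * P)) * S := by rw [hQP]
      _ = R * Q * (P * C * Q) * (P * S) := by noncomm_ring

/-- If in every conjugate of a matrix the two diagonal entries agree, the matrix is scalar. -/
lemma isScalarMatrix_of_conj_diag (h2 : (2 : F) ≠ 0) {A : Matrix (Fin 2) (Fin 2) F}
    (h : ∀ P Q : Matrix (Fin 2) (Fin 2) F, P * Q = 1 →
      (P * A * Q) 0 0 - (P * A * Q) 1 1 = 0) : IsScalarMatrix A := by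
  have e0 := h 1 1 (by simp)
  have e1 := h !![1, 1; 0, 1] !![1, -1; 0, 1] (by simp [Matrix.one_fin_two])
  have e2 := h !![1, 0; 1, 1] !![1, 0; -1, 1] (by simp [Matrix.one_fin_two])
  simp [Matrix.mul_apply, Fin.sum_univ_two, Matrix.vecMul, Matrix.vecHead,
    Matrix.vecTail] at e0 e1 e2
  refine ⟨mul_left_cancel₀ h2 ?_, mul_left_cancel₀ h2 ?_, sub_eq_zero.mp e0⟩
  · linear_combination e0 - e2
  · linear_combination e1 - e0

/-- If every conjugate of a matrix is symmetric, the matrix is scalar. -/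
lemma isScalarMatrix_of_conj_symm (h2 : (2 : F) ≠ 0) {A : Matrix (Fin 2) (Fin 2) F}
    (h : ∀ P Q : Matrix (Fin 2) (Fin 2) F, P * Q = 1 →
      (P * A * Q) 0 1 - (P * A * Q) 1 0 = 0) : IsScalarMatrix A := by
  have e0 := h 1 1 (by simp)
  have e1 := h !![1, 1; 0, 1] !![1, -1; 0, 1] (by simp [Matrix.one_fin_two])
  have e2 := h !![1, -1; 0, 1] !![1, 1; 0, 1] (by simp [Matrix.one_fin_two])
  simp [Matrix.mul_apply, Fin.sum_univ_two, Matrix.vecMul, Matrix.vecHead,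
    Matrix.vecTail] at e0 e1 e2
  have h10 : A 1 0 = 0 := mul_left_cancel₀ h2 (by linear_combination 2 * e0 - e1 - e2)
  refine ⟨by linear_combination e0 + h10, h10, mul_left_cancel₀ h2 ?_⟩
  linear_combination e2 - e1

/-- If every conjugate of a matrix is lower triangular, the matrix is scalar. -/
lemma isScalarMatrix_of_conj_lower (h2 : (2 : F) ≠ 0) {A : Matrix (Fin 2) (Fin 2) F}
    (h : ∀ P Q : Matrix (Fin 2) (Fin 2) F, P * Q = 1 → (P * A * Q) 0 1 = 0) :
    IsScalarMatrix A := by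
  have e0 := h 1 1 (by simp)
  have e1 := h !![1, 1; 0, 1] !![1, -1; 0, 1] (by simp [Matrix.one_fin_two])
  have e2 := h !![1, -1; 0, 1] !![1, 1; 0, 1] (by simp [Matrix.one_fin_two])
  simp [Matrix.mul_apply, Fin.sum_univ_two, Matrix.vecMul, Matrix.vecHead,
    Matrix.vecTail] at e0 e1 e2
  refine ⟨e0, mul_left_cancel₀ h2 ?_, mul_left_cancel₀ h2 ?_⟩
  · linear_combination 2 * e0 - e1 - e2
  · linear_combination e2 - e1

end Matrices

/-! ### Homogeneous bases -/

section Bases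

variable {F : Type*} [Field F]

/-- The basis `1, h, j, k` of `M₂(F)` with `h² = j² = 1`, `k = h j = -j h` and `k² = -1`. -/
def quaternionUnit : Fin 4 → Matrix (Fin 2) (Fin 2) F :=
  ![!![1, 0; 0, 1], !![1, 0; 0, -1], !![0, 1; 1, 0], !![0, 1; -1, 0]]

lemma exists_eq_sum_quaternionUnit (h2 : (2 : F) ≠ 0) (A : Matrix (Fin 2) (Fin 2) F) :
    ∃ c : Fin 4 → F, A = ∑ b, c b • quaternionUnit b := by
  refine ⟨![(A 0 0 + A 1 1) / 2, (A 0 0 - A 1 1) / 2, (A 0 1 + A 1 0) / 2,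
    (A 0 1 - A 1 0) / 2], ?_⟩
  ext i j
  fin_cases i <;> fin_cases j <;>
    simp [quaternionUnit, Fin.sum_univ_four] <;> field_simp <;> ring

/-- The matrix units `E₁₁, E₁₂, E₂₁, E₂₂`. -/
def matrixUnit : Fin 4 → Matrix (Fin 2) (Fin 2) F :=
  ![!![1, 0; 0, 0], !![0, 1; 0, 0], !![0, 0; 1, 0], !![0, 0; 0, 1]]

lemma exists_eq_sum_matrixUnit (A : Matrix (Fin 2) (Fin 2) F) :
    ∃ c : Fin 4 → F, A = ∑ b, c b • matrixUnit b := by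
  refine ⟨![A 0 0, A 0 1, A 1 0, A 1 1], ?_⟩
  ext i j
  fin_cases i <;> fin_cases j <;> simp [matrixUnit, Fin.sum_univ_four]

end Bases

/-! ### Equivariant multilinear maps on units -/

section Equivariant

variable {F : Type*} [Field F] {ι : Type*}

/-- A multilinear map on `M₂(F)` is equivariant if it commutes with simultaneous conjugation of
its arguments. The inverse of the conjugating matrix `P` is carried as a separate matrix `Q`. -/
def IsConjEquivariant
    (G : MultilinearMap F (fun _ : ι => Matrix (Fin 2) (Fin 2) F) (Matrix (Fin 2) (Fin 2) F)) :
    Prop :=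
  ∀ P Q : Matrix (Fin 2) (Fin 2) F, P * Q = 1 →
    ∀ m : ι → Matrix (Fin 2) (Fin 2) F, G (fun v => P * m v * Q) = P * G m * Q

variable {G : MultilinearMap F (fun _ : ι => Matrix (Fin 2) (Fin 2) F)
  (Matrix (Fin 2) (Fin 2) F)}

lemma IsConjEquivariant.conj_mem_range (hG : IsConjEquivariant G)
    {P Q A : Matrix (Fin 2) (Fin 2) F} (hPQ : P * Q = 1) (hA : A ∈ Set.range G) :
    P * A * Q ∈ Set.range G := by
  obtain ⟨m, rfl⟩ := hA
  exact ⟨_, hG P Q hPQ m⟩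

lemma IsConjEquivariant.mem_range_of_trace_eq_of_det_eq (hG : IsConjEquivariant G)
    {A B : Matrix (Fin 2) (Fin 2) F} (hA : A ∈ Set.range G) (hAs : ¬ IsScalarMatrix A)
    (hBs : ¬ IsScalarMatrix B) (ht : A.trace = B.trace) (hd : A.det = B.det) :
    B ∈ Set.range G := by
  obtain ⟨P, Q, hPQ, rfl⟩ := exists_conj_of_trace_eq_of_det_eq hAs hBs ht hd
  exact hG.conj_mem_range hPQ hA

/-- If conjugation by `P` scales each argument, it scales the value by the product of the
factors. -/
lemma IsConjEquivariant.conj_eq_prod_smul [Fintype ι] (hG : IsConjEquivariant G)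
    {P Q : Matrix (Fin 2) (Fin 2) F} (hPQ : P * Q = 1) {u : ι → Matrix (Fin 2) (Fin 2) F}
    {c : ι → F} (hu : ∀ v, P * u v * Q = c v • u v) :
    P * G u * Q = (∏ v, c v) • G u := by
  rw [← hG P Q hPQ, funext hu, G.map_smul_univ]

lemma smul_mem_range [Nonempty ι] {A : Matrix (Fin 2) (Fin 2) F} (hA : A ∈ Set.range G) (c : F) :
    c • A ∈ Set.range G := by
  classical
  obtain ⟨m, rfl⟩ := hA
  obtain ⟨i⟩ := ‹Nonempty ι›
  exact ⟨Function.update m i (c • m i), by rw [G.map_update_smul, Function.update_eq_self]⟩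

lemma exists_apply_unit_ne_zero [Fintype ι] {κ : Type*} [Fintype κ]
    {B : κ → Matrix (Fin 2) (Fin 2) F}
    (hB : ∀ A, ∃ c : κ → F, A = ∑ b, c b • B b) (φ : Matrix (Fin 2) (Fin 2) F →ₗ[F] F)
    {m : ι → Matrix (Fin 2) (Fin 2) F} (h : φ (G m) ≠ 0) :
    ∃ r : ι → κ, φ (G fun v => B (r v)) ≠ 0 := by
  classical
  by_contra! hr
  apply h
  choose c hc using hB
  have hm : m = fun v => ∑ b, c (m v) b • B b := funext fun v => hc (m v)
  rw [hm, G.map_sum, map_sum]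
  refine Finset.sum_eq_zero fun r _ => ?_
  rw [G.map_smul_univ (fun v => c (m v) (r v)) (fun v => B (r v)), map_smul, hr, smul_zero]

/-- The values on quaternion units are homogeneous for the grading of `M₂(F)` by the Klein four
group, whose components are the lines spanned by the quaternion units. -/
lemma IsConjEquivariant.exists_apply_quaternionUnit_eq [Fintype ι] (h2 : (2 : F) ≠ 0)
    (hG : IsConjEquivariant G) (r : ι → Fin 4) :
    ∃ (d : Fin 4) (α : F), (G fun v => quaternionUnit (r v)) = α • quaternionUnit d := by
  set X := G fun v => quaternionUnit (r v) with hX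
  -- The components are the joint eigenspaces of the conjugations by `h` and by `j`.
  have hh := hG.conj_eq_prod_smul (P := !![1, 0; 0, -1]) (Q := !![1, 0; 0, -1])
    (by simp [Matrix.one_fin_two]) (u := fun v => quaternionUnit (r v))
    (c := fun v => (![1, 1, -1, -1] : Fin 4 → F) (r v)) (fun v => by
      generalize r v = b
      fin_cases b <;> simp [quaternionUnit])
  have hj := hG.conj_eq_prod_smul (P := !![0, 1; 1, 0]) (Q := !![0, 1; 1, 0])
    (by simp [Matrix.one_fin_two]) (u := fun v => quaternionUnit (r v))
    (c := fun v => (![1, -1, 1, -1] : Fin 4 → F) (r v)) (fun v => by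
      generalize r v = b
      fin_cases b <;> simp [quaternionUnit])
  rw [← hX] at hh hj
  have sign : ∀ c : Fin 4 → F, (∀ b, c b = 1 ∨ c b = -1) →
      ∏ v, c (r v) = 1 ∨ ∏ v, c (r v) = -1 := by
    intro c hc
    refine Finset.prod_induction _ (fun x => x = 1 ∨ x = -1) ?_ (Or.inl rfl) fun v _ => hc (r v)
    rintro x y (rfl | rfl) (rfl | rfl) <;> simp
  have two_cancel : ∀ x : F, x = -x → x = 0 := fun x hx =>
    mul_left_cancel₀ h2 (by linear_combination hx)
  have sh := sign ![1, 1, -1, -1] (fun b => by fin_cases b <;> simp)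
  have sj := sign ![1, -1, 1, -1] (fun b => by fin_cases b <;> simp)
  have hX2 := Matrix.eta_fin_two X
  rcases sh with sh | sh <;> rcases sj with sj | sj <;> rw [sh] at hh <;> rw [sj] at hj
  all_goals
    have h00 := congrFun (congrFun hh 0) 0
    have h01 := congrFun (congrFun hh 0) 1
    have h10 := congrFun (congrFun hh 1) 0
    have j00 := congrFun (congrFun hj 0) 0
    have j01 := congrFun (congrFun hj 0) 1
    simp [Matrix.mul_apply, Fin.sum_univ_two, Matrix.vecMul, Matrix.vecHead, Matrix.vecTail]
      at h00 h01 h10 j00 j01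
  · refine ⟨0, X 0 0, hX2.trans ?_⟩
    simp [quaternionUnit, j00, two_cancel _ h01.symm, two_cancel _ h10.symm]
  · refine ⟨1, X 0 0, hX2.trans ?_⟩
    simp [quaternionUnit, j00, two_cancel _ h01.symm, two_cancel _ h10.symm]
  · refine ⟨2, X 0 1, hX2.trans ?_⟩
    simp [quaternionUnit, j00, j01, two_cancel _ h00]
  · refine ⟨3, X 0 1, hX2.trans ?_⟩
    simp [quaternionUnit, j00, j01, two_cancel _ h00]

/-- A linear form that vanishes on all quaternion units but one detects that unit among the
values. -/
lemma IsConjEquivariant.exists_apply_eq_smul_quaternionUnit [Fintype ι] (h2 : (2 : F) ≠ 0)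
    (hG : IsConjEquivariant G) {φ : Matrix (Fin 2) (Fin 2) F →ₗ[F] F} {d : Fin 4}
    (hφ : ∀ b, b ≠ d → φ (quaternionUnit b) = 0)
    {m : ι → Matrix (Fin 2) (Fin 2) F} (hm : φ (G m) ≠ 0) :
    ∃ (r : ι → Fin 4) (α : F), α ≠ 0 ∧
      (G fun v => quaternionUnit (r v)) = α • quaternionUnit d := by
  obtain ⟨r, hr⟩ := exists_apply_unit_ne_zero (exists_eq_sum_quaternionUnit h2) φ hm
  obtain ⟨b, α, hα⟩ := hG.exists_apply_quaternionUnit_eq h2 r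
  rw [hα, map_smul, smul_eq_mul] at hr
  obtain rfl : b = d := by
    by_contra hb
    exact hr (by rw [hφ b hb, mul_zero])
  exact ⟨r, α, left_ne_zero_of_mul hr, hα⟩

lemma IsConjEquivariant.exists_apply_eq_smul_one [Fintype ι] (h2 : (2 : F) ≠ 0)
    (hG : IsConjEquivariant G) {m : ι → Matrix (Fin 2) (Fin 2) F} (hm : (G m).trace ≠ 0) :
    ∃ (r : ι → Fin 4) (α : F), α ≠ 0 ∧
      (G fun v => quaternionUnit (r v)) = α • quaternionUnit 0 := by
  refine hG.exists_apply_eq_smul_quaternionUnit h2 (φ := Matrix.traceLinearMap (Fin 2) F F)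
    (m := m) (fun b hb => ?_) hm
  fin_cases b <;> simp [quaternionUnit, Matrix.trace_fin_two] at hb ⊢

lemma IsConjEquivariant.exists_apply_eq_smul_h [Fintype ι] (h2 : (2 : F) ≠ 0)
    (hG : IsConjEquivariant G) {m : ι → Matrix (Fin 2) (Fin 2) F}
    (hm : ¬ IsScalarMatrix (G m)) :
    ∃ (r : ι → Fin 4) (α : F), α ≠ 0 ∧
      (G fun v => quaternionUnit (r v)) = α • quaternionUnit 1 := by
  by_contra hcon
  refine hm (isScalarMatrix_of_conj_diag h2 fun P Q hPQ => ?_)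
  by_contra hne
  rw [← hG P Q hPQ] at hne
  refine hcon (hG.exists_apply_eq_smul_quaternionUnit h2
    (φ := Matrix.entryLinearMap F F 0 0 - Matrix.entryLinearMap F F 1 1) (fun b hb => ?_) hne)
  fin_cases b <;> simp [quaternionUnit] at hb ⊢

lemma IsConjEquivariant.exists_apply_eq_smul_k [Fintype ι] (h2 : (2 : F) ≠ 0)
    (hG : IsConjEquivariant G) {m : ι → Matrix (Fin 2) (Fin 2) F}
    (hm : ¬ IsScalarMatrix (G m)) :
    ∃ (r : ι → Fin 4) (α : F), α ≠ 0 ∧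
      (G fun v => quaternionUnit (r v)) = α • quaternionUnit 3 := by
  by_contra hcon
  refine hm (isScalarMatrix_of_conj_symm h2 fun P Q hPQ => ?_)
  by_contra hne
  rw [← hG P Q hPQ] at hne
  refine hcon (hG.exists_apply_eq_smul_quaternionUnit h2
    (φ := Matrix.entryLinearMap F F 0 1 - Matrix.entryLinearMap F F 1 0) (fun b hb => ?_) hne)
  fin_cases b <;> simp [quaternionUnit] at hb ⊢

/-- An equivariant map with a value that is not scalar takes nonzero nilpotent values: on matrix
units it is homogeneous for the weights of the diagonal torus, and a value with a nonzero entry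
at `(0, 1)` is homogeneous only if it is a multiple of `E₁₂`. -/
lemma IsConjEquivariant.exists_smul_matrixUnit_mem_range [Fintype ι] [Infinite F]
    (h2 : (2 : F) ≠ 0) (hG : IsConjEquivariant G) {m : ι → Matrix (Fin 2) (Fin 2) F}
    (hm : ¬ IsScalarMatrix (G m)) :
    ∃ α : F, α ≠ 0 ∧ !![0, α; 0, 0] ∈ Set.range G := by
  classical
  obtain ⟨m', hm'⟩ : ∃ m', Matrix.entryLinearMap F F 0 1 (G m') ≠ 0 := by
    by_contra! hcon
    refine hm (isScalarMatrix_of_conj_lower h2 fun P Q hPQ => ?_)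
    rw [← hG P Q hPQ]
    exact hcon _
  obtain ⟨r, hr⟩ := exists_apply_unit_ne_zero exists_eq_sum_matrixUnit _ hm'
  obtain ⟨c, hc⟩ := Infinite.exists_notMem_finset ({0, 1, -1} : Finset F)
  simp only [Finset.mem_insert, Finset.mem_singleton, not_or] at hc
  obtain ⟨hc0, hc1, hc2⟩ := hc
  have key := hG.conj_eq_prod_smul (P := !![c, 0; 0, 1]) (Q := !![c⁻¹, 0; 0, 1])
    (by simp [Matrix.one_fin_two, hc0]) (u := fun v => matrixUnit (r v))
    (c := fun v => (![1, c, c⁻¹, 1] : Fin 4 → F) (r v)) (fun v => by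
      generalize r v = b
      ext i j
      fin_cases b <;> fin_cases i <;> fin_cases j <;> simp [matrixUnit, hc0])
  refine ⟨_, hr, fun v => matrixUnit (r v), ?_⟩
  generalize (G fun v => matrixUnit (r v)) = X at key hr ⊢
  generalize (∏ v, (![1, c, c⁻¹, 1] : Fin 4 → F) (r v)) = t at key
  simp only [Matrix.entryLinearMap_apply] at hr ⊢
  have e01 := congrFun (congrFun key 0) 1
  have e00 := congrFun (congrFun key 0) 0
  have e11 := congrFun (congrFun key 1) 1
  have e10 := congrFun (congrFun key 1) 0
  simp [Matrix.mul_apply, Fin.sum_univ_two, Matrix.vecMul, Matrix.vecHead, Matrix.vecTail]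
    at e00 e01 e10 e11
  obtain rfl : c = t := e01.resolve_right hr
  have hc3 : 1 - c ≠ 0 := sub_ne_zero.mpr (Ne.symm hc1)
  have hc4 : 1 + c ≠ 0 := fun h => hc2 (by linear_combination h)
  have x11 : X 1 1 = 0 := (mul_eq_zero.mp (by linear_combination e11 :
    (1 - c) * X 1 1 = 0)).resolve_left hc3
  have x00 : X 0 0 = 0 := by
    rw [mul_right_comm, mul_inv_cancel₀ hc0, one_mul] at e00
    exact (mul_eq_zero.mp (by linear_combination e00 :
      (1 - c) * X 0 0 = 0)).resolve_left hc3
  have x10 : X 1 0 = 0 := by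
    rw [← div_eq_mul_inv, div_eq_iff hc0] at e10
    exact (mul_eq_zero.mp (by linear_combination e10 :
      ((1 - c) * (1 + c)) * X 1 0 = 0)).resolve_left (mul_ne_zero hc3 hc4)
  simpa [x00, x11, x10] using Matrix.eta_fin_two X

end Equivariant

/-! ### Polynomial functions on lines -/

section PolynomialFunctions

variable {F : Type*} [Field F] {ι : Type*}

/-- The algebra of polynomial functions `F → F`. -/
noncomputable def polynomialFunctions (F : Type*) [Field F] : Subalgebra F (F → F) :=
  (Polynomial.aeval (id : F → F)).range

lemma mem_polynomialFunctions {φ : F → F} :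
    φ ∈ polynomialFunctions F ↔ ∃ p : Polynomial F, ∀ t, φ t = p.eval t := by
  simp only [polynomialFunctions, AlgHom.mem_range, funext_iff, Polynomial.aeval_fn_apply, id,
    Polynomial.coe_aeval_eq_eval, eq_comm]

lemma pow_mem_polynomialFunctions (n : ℕ) : (fun t : F => t ^ n) ∈ polynomialFunctions F :=
  mem_polynomialFunctions.mpr ⟨Polynomial.X ^ n, by simp⟩

lemma exists_ne_zero_and_ne_zero [Infinite F] {φ ψ : F → F} (hφ : φ ∈ polynomialFunctions F)
    (hψ : ψ ∈ polynomialFunctions F) {a b : F} (ha : φ a ≠ 0) (hb : ψ b ≠ 0) :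
    ∃ t, φ t ≠ 0 ∧ ψ t ≠ 0 := by
  obtain ⟨p, hp⟩ := mem_polynomialFunctions.mp hφ
  obtain ⟨q, hq⟩ := mem_polynomialFunctions.mp hψ
  by_contra! h
  have hpq : p * q = 0 := Polynomial.funext fun t => by
    rw [Polynomial.eval_mul, ← hp, ← hq, Polynomial.eval_zero]
    by_cases ht : φ t = 0
    · rw [ht, zero_mul]
    · rw [h t ht, mul_zero]
  rcases mul_eq_zero.mp hpq with rfl | rfl
  · exact ha (by rw [hp, Polynomial.eval_zero])
  · exact hb (by rw [hq, Polynomial.eval_zero])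

variable (G : MultilinearMap F (fun _ : ι => Matrix (Fin 2) (Fin 2) F)
  (Matrix (Fin 2) (Fin 2) F))

lemma entry_mem_polynomialFunctions [Fintype ι] (a b : ι → Matrix (Fin 2) (Fin 2) F)
    (i j : Fin 2) :
    (fun t : F => G (a + t • b) i j) ∈ polynomialFunctions F := by
  classical
  have h : (fun t : F => G (a + t • b) i j) =
      ∑ s : Finset ι, G (s.piecewise a b) i j • fun t : F => t ^ sᶜ.card := by
    funext t
    rw [G.map_add_univ, Finset.sum_apply, Matrix.sum_apply]
    refine Finset.sum_congr rfl fun s _ => ?_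
    have hs : s.piecewise a (t • b) =
        sᶜ.piecewise (fun v => t • s.piecewise a b v) (s.piecewise a b) := by
      funext v
      by_cases hv : v ∈ s <;> simp [Finset.piecewise, hv]
    rw [hs, G.map_piecewise_smul (fun _ => t), Finset.prod_const]
    simp [mul_comm]
  rw [h]
  exact sum_mem fun s _ => Subalgebra.smul_mem _ (pow_mem_polynomialFunctions _) _

lemma trace_mem_polynomialFunctions [Fintype ι] (a b : ι → Matrix (Fin 2) (Fin 2) F) :
    (fun t : F => (G (a + t • b)).trace) ∈ polynomialFunctions F := by
  simp only [Matrix.trace_fin_two]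
  exact add_mem (entry_mem_polynomialFunctions G a b 0 0) (entry_mem_polynomialFunctions G a b 1 1)

lemma polarDisc_mem_polynomialFunctions [Fintype ι] (a b a' b' : ι → Matrix (Fin 2) (Fin 2) F) :
    (fun t : F => polarDisc (G (a + t • b)) (G (a' + t • b'))) ∈ polynomialFunctions F := by
  have e := entry_mem_polynomialFunctions G a b
  have e' := entry_mem_polynomialFunctions G a' b'
  exact add_mem (mul_mem (sub_mem (e 0 0) (e 1 1)) (sub_mem (e' 0 0) (e' 1 1)))
    (mul_mem (Subalgebra.algebraMap_mem _ 2)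
      (add_mem (mul_mem (e 0 1) (e' 1 0)) (mul_mem (e 1 0) (e' 0 1))))

end PolynomialFunctions

/-! ### Separating two degrees in one variable -/

section Separation

variable {F : Type*} [Field F] {ι : Type*} [Fintype ι] [DecidableEq ι]
  {G : MultilinearMap F (fun _ : ι => Matrix (Fin 2) (Fin 2) F) (Matrix (Fin 2) (Fin 2) F)}

/-- A linear map with the scalar matrices as kernel that preserves `polarDisc`. -/
def modScalar (F : Type*) [Field F] :
    Matrix (Fin 2) (Fin 2) F →ₗ[F] Matrix (Fin 2) (Fin 2) F :=
  LinearMap.id - (Matrix.entryLinearMap F F 1 1).smulRight 1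

lemma modScalar_apply (A : Matrix (Fin 2) (Fin 2) F) : modScalar F A = A - A 1 1 • 1 := rfl

lemma modScalar_quaternionUnit_zero : modScalar F (quaternionUnit 0) = 0 := by
  simp [modScalar_apply, quaternionUnit, Matrix.one_fin_two]

lemma polarDisc_modScalar (A B : Matrix (Fin 2) (Fin 2) F) :
    polarDisc (modScalar F A) (modScalar F B) = polarDisc A B := by
  simp [polarDisc, modScalar_apply]

lemma disc_modScalar (A : Matrix (Fin 2) (Fin 2) F) : disc (modScalar F A) = disc A := by
  rw [← polarDisc_self, polarDisc_modScalar, polarDisc_self]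

/-- Suppose that `G` has scalar values at all tuples of units strictly between `r` and `r'`. If
the variables in which `r` and `r'` differ, except for one, are replaced by the sums of the units
that `r` and `r'` prescribe, the value does not change modulo scalars. -/
lemma modScalar_apply_update (B : Fin 4 → Matrix (Fin 2) (Fin 2) F) {r r' : ι → Fin 4}
    (h : ∀ q : ι → Fin 4, (∀ v, q v = r v ∨ q v = r' v) → q ≠ r → q ≠ r' →
      modScalar F (G fun v => B (q v)) = 0)
    {z : ι → Matrix (Fin 2) (Fin 2) F}
    (hz : ∀ v, r v ≠ r' v → z v = B (r v) + B (r' v)) (hz' : ∀ v, r v = r' v → z v = B (r v))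
    {i : ι} (hi : r i ≠ r' i) :
    modScalar F (G (Function.update z i (B (r i)))) = modScalar F (G fun v => B (r v)) := by
  set b : ι → Matrix (Fin 2) (Fin 2) F :=
    fun v => if v = i ∨ r v = r' v then 0 else B (r' v) with hb
  have hsum : Function.update z i (B (r i)) = (fun v => B (r v)) + b := by
    funext v
    by_cases hv : v = i
    · subst hv
      simp [hb]
    · by_cases hr : r v = r' v
      · simp [hb, hv, hr, hz' v hr]
      · simp [hb, hv, hr, hz v hr]
  rw [hsum, G.map_add_univ, map_sum, Finset.sum_eq_single Finset.univ]
  · rw [Finset.piecewise_univ]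
  · intro s _ hs
    by_cases hzero : ∃ v, v ∉ s ∧ (v = i ∨ r v = r' v)
    · obtain ⟨v, hvs, hv⟩ := hzero
      rw [G.map_coord_zero v (by rw [Finset.piecewise_eq_of_notMem _ _ _ hvs]; exact if_pos hv),
        map_zero]
    · push Not at hzero
      have hpw : s.piecewise (fun v => B (r v)) b = fun v => B (s.piecewise r r' v) := by
        funext v
        by_cases hv : v ∈ s
        · simp [hv]
        · simp [hv, hb, hzero v hv]
      rw [hpw]
      refine h _ (fun v => ?_) (fun heq => ?_) fun heq => ?_
      · by_cases hv : v ∈ s <;> simp [hv]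
      · obtain ⟨v, hv⟩ : ∃ v, v ∉ s := by
          by_contra! hall
          exact hs (Finset.eq_univ_iff_forall.mpr hall)
        have := congrFun heq v
        rw [Finset.piecewise_eq_of_notMem _ _ _ hv] at this
        exact (hzero v hv).2 this.symm
      · have his : i ∈ s := by
          by_contra his
          exact (hzero i his).1 rfl
        have := congrFun heq i
        rw [Finset.piecewise_eq_of_mem _ _ _ his] at this
        exact hi this
  · exact fun hu => absurd (Finset.mem_univ _) hu

lemma polarDisc_sq_ne_of_quaternionUnit (h2 : (2 : F) ≠ 0) {α β : F} (hα : α ≠ 0) (hβ : β ≠ 0)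
    {d d' : Fin 4} (hd : d ≠ 0) (hd' : d' ≠ 0) (hdd : d ≠ d') :
    polarDisc (α • quaternionUnit (F := F) d) (β • quaternionUnit (F := F) d') ^ 2 ≠
      disc (α • quaternionUnit (F := F) d) * disc (β • quaternionUnit (F := F) d') := by
  -- Different units are orthogonal, and none is isotropic.
  have horth : polarDisc (α • quaternionUnit (F := F) d) (β • quaternionUnit (F := F) d') = 0 := by
    fin_cases d <;> fin_cases d' <;> simp [polarDisc, quaternionUnit] at hd hd' hdd ⊢
  have h4 : (4 : F) ≠ 0 := by
    rw [show (4 : F) = 2 * 2 by norm_num]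
    exact mul_ne_zero h2 h2
  have hne : ∀ (c : F) (b : Fin 4), c ≠ 0 → b ≠ 0 →
      disc (c • quaternionUnit (F := F) b) ≠ 0 := by
    intro c b hc hb
    fin_cases b <;> simp [disc, quaternionUnit] at hb ⊢ <;> ring_nf <;> simp [hc, h2, h4]
  rw [horth]
  intro h
  exact mul_ne_zero (hne α d hα hd) (hne β d' hβ hd') (by rw [← h]; ring)

/-- The form induced by `disc` along a single variable has rank at least two for some value of
the other variables. Two unit tuples of different nonzero degree are brought as close together
as possible; then `modScalar_apply_update` applies to them. -/
lemma IsConjEquivariant.exists_polarDisc_sq_ne (h2 : (2 : F) ≠ 0) (hG : IsConjEquivariant G)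
    {r r' : ι → Fin 4} {d d' : Fin 4} {α β : F} (hα : α ≠ 0) (hβ : β ≠ 0)
    (hd : d ≠ 0) (hd' : d' ≠ 0) (hdd : d ≠ d')
    (hr : (G fun v => quaternionUnit (r v)) = α • quaternionUnit d)
    (hr' : (G fun v => quaternionUnit (r' v)) = β • quaternionUnit d') :
    ∃ (z : ι → Matrix (Fin 2) (Fin 2) F) (i : ι) (x y : Matrix (Fin 2) (Fin 2) F),
      polarDisc (G (Function.update z i x)) (G (Function.update z i y)) ^ 2 ≠
        disc (G (Function.update z i x)) * disc (G (Function.update z i y)) := by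
  induction hn : hammingDist r r' using Nat.strong_induction_on generalizing r r' d d' α β with
  | _ n ih =>
  by_cases h : ∀ q : ι → Fin 4, (∀ v, q v = r v ∨ q v = r' v) → q ≠ r → q ≠ r' →
      modScalar F (G fun v => quaternionUnit (q v)) = 0
  · obtain ⟨i, hi⟩ : ∃ i, r i ≠ r' i := by
      by_contra! hrr
      obtain rfl : r = r' := funext hrr
      refine polarDisc_sq_ne_of_quaternionUnit h2 hα hβ hd hd' hdd ?_
      rw [← hr, ← hr', polarDisc_self, sq]
    set z : ι → Matrix (Fin 2) (Fin 2) F := fun v =>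
      if r v = r' v then quaternionUnit (r v)
      else quaternionUnit (r v) + quaternionUnit (r' v) with hz
    refine ⟨z, i, quaternionUnit (r i), quaternionUnit (r' i), ?_⟩
    have e := modScalar_apply_update quaternionUnit h (z := z) (fun v hv => by simp [hz, hv])
      (fun v hv => by simp [hz, hv]) hi
    have e' := modScalar_apply_update quaternionUnit
      (fun q hq hqr hqr' => h q (fun v => (hq v).symm) hqr' hqr) (z := z)
      (fun v hv => by simp [hz, Ne.symm hv, add_comm]) (fun v hv => by simp [hz, hv]) hi.symm
    rw [← polarDisc_modScalar, ← disc_modScalar, ← disc_modScalar (G (Function.update z i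
      (quaternionUnit (r' i)))), e, e', polarDisc_modScalar, disc_modScalar, disc_modScalar,
      hr, hr']
    exact polarDisc_sq_ne_of_quaternionUnit h2 hα hβ hd hd' hdd
  · push Not at h
    obtain ⟨q, hq, hqr, hqr', hne⟩ := h
    obtain ⟨e, γ, he⟩ := hG.exists_apply_quaternionUnit_eq h2 q
    rw [he, map_smul] at hne
    have hγ : γ ≠ 0 := fun h0 => hne (by rw [h0, zero_smul])
    have he0 : e ≠ 0 := fun h0 => hne (by rw [h0, modScalar_quaternionUnit_zero, smul_zero])
    have hlt : ∀ {p p' : ι → Fin 4}, (∀ v, q v = p v ∨ q v = p' v) → q ≠ p' →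
        hammingDist p q < hammingDist p p' := by
      intro p p' hpq hne'
      obtain ⟨v, hv⟩ := Function.ne_iff.mp hne'
      refine Finset.card_lt_card ((Finset.ssubset_iff_of_subset fun w hw => ?_).mpr ⟨v, ?_, ?_⟩)
      · simp only [Finset.mem_filter, Finset.mem_univ, true_and] at hw ⊢
        rcases hpq w with h | h
        · exact absurd h.symm hw
        · rwa [← h]
      · simp only [Finset.mem_filter, Finset.mem_univ, true_and]
        rcases hpq v with h | h
        · rwa [← h]
        · exact absurd h hv
      · simp only [Finset.mem_filter, Finset.mem_univ, true_and, not_not]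
        exact ((hpq v).resolve_right hv).symm
    by_cases hde : d = e
    · refine ih _ ?_ hγ hβ he0 hd' (hde ▸ hdd) he hr' rfl
      rw [← hn, hammingDist_comm, hammingDist_comm r]
      exact hlt (fun v => (hq v).symm) hqr
    · refine ih _ ?_ hα hγ hd he0 hde hr he rfl
      rw [← hn]
      exact hlt hq hqr'

end Separation

/-! ### Prescribing the discriminant relative to the trace -/

section QuadraticallyClosed

variable {F : Type*} [Field F]

/-- If the restriction of `disc` to the plane spanned by `X` and `W` is nondegenerate, it takes
every value on the line `X + s W`, at a matrix that is not scalar. -/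
lemma exists_disc_add_smul_eq (h2 : (2 : F) ≠ 0) (hsq : IsQuadraticallyClosed F)
    {X W : Matrix (Fin 2) (Fin 2) F} (hXW : polarDisc X W ^ 2 ≠ disc X * disc W) (c : F) :
    ∃ s : F, disc (X + s • W) = c ∧ ¬ IsScalarMatrix (X + s • W) := by
  -- The polynomial `disc (X + s W)` in `s` is not constant, so it takes every value.
  obtain ⟨s, hs⟩ : ∃ s : F, disc (X + s • W) = c := by
    simp only [disc_add_smul]
    by_cases hW : disc W = 0
    · have hp : polarDisc X W ≠ 0 := fun h => hXW (by rw [h, hW]; ring)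
      refine ⟨(c - disc X) / (2 * polarDisc X W), ?_⟩
      rw [hW]
      field_simp
      ring
    · obtain ⟨δ, hδ⟩ := hsq (polarDisc X W ^ 2 - (disc X - c) * disc W)
      refine ⟨(δ - polarDisc X W) / disc W, ?_⟩
      field_simp
      linear_combination -hδ
  refine ⟨s, hs, fun hsc => hXW ?_⟩
  -- If `X + s W` is scalar, then `X` and `-s W` agree up to scalars.
  have h1 := hsc.polarDisc_eq_zero W
  have h3 := hsc.polarDisc_eq_zero X
  rw [polarDisc_add_smul_left, polarDisc_self] at h1 h3
  rw [polarDisc_comm W X] at h3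
  linear_combination polarDisc X W * h1 - disc W * h3

variable {ι : Type*} [Fintype ι] {G : MultilinearMap F (fun _ : ι => Matrix (Fin 2) (Fin 2) F)
  (Matrix (Fin 2) (Fin 2) F)}

/-- Over a quadratically closed field, the ratio of the discriminant to the square of the trace
takes every value on the image: this is arranged in one variable, on a line on which the trace is
constant and the discriminant is not. -/
lemma IsConjEquivariant.exists_disc_eq_mul_trace_sq_of_isQuadraticallyClosed [Infinite F]
    (h2 : (2 : F) ≠ 0) (hsq : IsQuadraticallyClosed F) (hG : IsConjEquivariant G)
    {m m' : ι → Matrix (Fin 2) (Fin 2) F} (hm : ¬ IsScalarMatrix (G m))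
    (hm' : (G m').trace ≠ 0) (c : F) :
    ∃ A ∈ Set.range G, ¬ IsScalarMatrix A ∧ A.trace ≠ 0 ∧ disc A = c * A.trace ^ 2 := by
  classical
  obtain ⟨r, α, hα, hr⟩ := hG.exists_apply_eq_smul_h h2 hm
  obtain ⟨r', β, hβ, hr'⟩ := hG.exists_apply_eq_smul_k h2 hm
  obtain ⟨z, i, x, y, hD⟩ := hG.exists_polarDisc_sq_ne h2 hα hβ (by decide) (by decide)
    (by decide) hr hr'
  -- Move along the line from `update z i x` to `m'` to make the trace nonzero as well.
  set p := Function.update z i x with hp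
  set q := Function.update z i y with hq
  have htr := trace_mem_polynomialFunctions G p (m' - p)
  have hpoly : (fun t : F => polarDisc (G (p + t • (m' - p))) (G (q + t • (m' - p))) ^ 2 -
      disc (G (p + t • (m' - p))) * disc (G (q + t • (m' - p)))) ∈ polynomialFunctions F := by
    simp only [← polarDisc_self]
    exact sub_mem (pow_mem (polarDisc_mem_polynomialFunctions G _ _ _ _) 2)
      (mul_mem (polarDisc_mem_polynomialFunctions G _ _ _ _)
        (polarDisc_mem_polynomialFunctions G _ _ _ _))
  obtain ⟨t, ht, ht'⟩ := exists_ne_zero_and_ne_zero hpoly htr (a := 0) (b := 1)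
    (by simpa [sub_eq_zero] using hD) (by simpa using hm')
  set P := p + t • (m' - p) with hP
  set y' := y + t • (m' i - x) with hy'
  have hQ : q + t • (m' - p) = Function.update P i y' := by
    funext v
    by_cases hv : v = i
    · subst hv
      simp [hp, hq, hy']
    · simp [hp, hq, hP, hv]
  rw [hQ] at ht
  set Y := G (Function.update P i y') with hY
  set X := G P with hX
  -- The direction `W` has trace zero.
  set W := X.trace • Y - Y.trace • X with hW
  have hXW : polarDisc X W ^ 2 ≠ disc X * disc W := by
    have : polarDisc X W ^ 2 - disc X * disc W =
        X.trace ^ 2 * (polarDisc X Y ^ 2 - disc X * disc Y) := by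
      simp only [hW, polarDisc, disc, Matrix.sub_apply, Matrix.smul_apply, smul_eq_mul]
      ring
    rw [← sub_ne_zero, this]
    exact mul_ne_zero (pow_ne_zero 2 ht') ht
  have hWtr : W.trace = 0 := by
    simp only [hW, Matrix.trace_sub, Matrix.trace_smul, smul_eq_mul]
    ring
  obtain ⟨s, hs, hns⟩ := exists_disc_add_smul_eq h2 hsq hXW (c * X.trace ^ 2)
  have hst : (X + s • W).trace = X.trace := by
    rw [Matrix.trace_add, Matrix.trace_smul, hWtr, smul_zero, add_zero]
  refine ⟨X + s • W, ⟨Function.update P i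
    (P i + s • (X.trace • y' - Y.trace • P i)), ?_⟩, hns, by rwa [hst], by rw [hs, hst]⟩
  rw [G.map_update_add, G.map_update_smul, G.map_update_sub, G.map_update_smul,
    G.map_update_smul, Function.update_eq_self]

end QuadraticallyClosed

section Real

variable {F : Type*} [Field F]

/-- The form `disc - c tr²`, whose zeros are the matrices with `disc = c tr²`. -/
def discSub (c : F) (A : Matrix (Fin 2) (Fin 2) F) : F :=
  disc A - c * A.trace ^ 2

/-- If the discriminant of the binary form `discSub c` on the plane spanned by `X` and `Y` is the
nonzero square `δ²`, then the form has a zero with nonzero trace that is not scalar. -/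
lemma exists_discSub_add_smul_eq_zero {c δ : F} {X Y : Matrix (Fin 2) (Fin 2) F} (h2 : (2 : F) ≠ 0)
    (hδ : (polarDisc X Y - c * (X.trace * Y.trace)) ^ 2 - discSub c X * discSub c Y = δ * δ)
    (hδ0 : δ ≠ 0) (hY : discSub c Y ≠ 0) (hX : X.trace ≠ 0) :
    ∃ t : F, discSub c (X + t • Y) = 0 ∧ (X + t • Y).trace ≠ 0 ∧
      ¬ IsScalarMatrix (X + t • Y) := by
  set b := polarDisc X Y - c * (X.trace * Y.trace) with hb
  have expand : ∀ t, discSub c (X + t • Y) =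
      discSub c X + 2 * t * b + t ^ 2 * discSub c Y := by
    intro t
    rw [discSub, disc_add_smul, Matrix.trace_add, Matrix.trace_smul, hb, discSub, discSub,
      smul_eq_mul]
    ring
  -- The two roots differ, so the trace is nonzero at one of them.
  obtain ⟨t, ht, htr⟩ : ∃ t : F, discSub c (X + t • Y) = 0 ∧ (X + t • Y).trace ≠ 0 := by
    have h1 : discSub c (X + ((δ - b) / discSub c Y) • Y) = 0 := by
      rw [expand]
      field_simp
      linear_combination -hδ
    have h3 : discSub c (X + ((-δ - b) / discSub c Y) • Y) = 0 := by
      rw [expand]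
      field_simp
      linear_combination -hδ
    by_contra! hcon
    have e1 := hcon _ h1
    have e3 := hcon _ h3
    rw [Matrix.trace_add, Matrix.trace_smul, smul_eq_mul] at e1 e3
    have hYt : Y.trace = 0 := by
      have : 2 * δ / discSub c Y * Y.trace = 0 := by linear_combination e1 - e3
      exact (mul_eq_zero.mp this).resolve_left (div_ne_zero (mul_ne_zero h2 hδ0) hY)
    rw [hYt, mul_zero, add_zero] at e1
    exact hX e1
  refine ⟨t, ht, htr, fun hsc => hδ0 ?_⟩
  -- A scalar root forces `c = 0`, and then `X` and `-t Y` agree up to scalars.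
  have hc : c = 0 := by
    rw [discSub, hsc.disc_eq_zero, zero_sub, neg_eq_zero] at ht
    exact (mul_eq_zero.mp ht).resolve_right (pow_ne_zero 2 htr)
  have e1 := hsc.polarDisc_eq_zero Y
  have e3 := hsc.polarDisc_eq_zero X
  rw [polarDisc_add_smul_left, polarDisc_self] at e1 e3
  rw [polarDisc_comm Y X] at e3
  rw [hb, discSub, discSub, hc] at hδ
  exact mul_self_eq_zero.mp (by
    linear_combination -hδ + polarDisc X Y * e1 - disc Y * e3)

variable {ι : Type*} [Fintype ι] {G : MultilinearMap F (fun _ : ι => Matrix (Fin 2) (Fin 2) F)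
  (Matrix (Fin 2) (Fin 2) F)}

lemma discSub_mem_polynomialFunctions (G : MultilinearMap F
    (fun _ : ι => Matrix (Fin 2) (Fin 2) F) (Matrix (Fin 2) (Fin 2) F)) (c : F)
    (a b : ι → Matrix (Fin 2) (Fin 2) F) :
    (fun t : F => discSub c (G (a + t • b))) ∈ polynomialFunctions F := by
  simp only [discSub, ← polarDisc_self]
  exact sub_mem (polarDisc_mem_polynomialFunctions G _ _ _ _)
    (mul_mem (Subalgebra.algebraMap_mem _ c) (pow_mem (trace_mem_polynomialFunctions G _ _) 2))

/-- Changing the arguments from `z` to `z'` one variable at a time, some single step leads from a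
value satisfying `p` to a value satisfying `p'`. -/
lemma exists_update_of_piecewise [DecidableEq ι] {α : Type*} {p p' : (ι → α) → Prop}
    {z z' : ι → α} (hz : p z) (hp : ¬ p z')
    (h : ∀ s : Finset ι, p (s.piecewise z' z) ∨ p' (s.piecewise z' z)) :
    ∃ (s : Finset ι) (i : ι), p (s.piecewise z' z) ∧
      p' (Function.update (s.piecewise z' z) i (z' i)) := by
  by_contra! hcon
  have all : ∀ s : Finset ι, p (s.piecewise z' z) := by
    intro s
    induction s using Finset.induction_on with
    | empty => simpa using hz
    | insert i s _ ih =>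
      refine (h _).resolve_right ?_
      rw [Finset.piecewise_insert]
      exact hcon s i ih
  exact hp (by simpa using all Finset.univ)

/-- Two polynomial functions over the reals that are positive at `0` are both positive at some
point at which a third one, not identically zero, does not vanish. -/
lemma exists_pos_and_pos_and_ne_zero (σ : F ≃+* ℝ) {φ ψ χ : F → F}
    (hφ : φ ∈ polynomialFunctions F) (hψ : ψ ∈ polynomialFunctions F)
    (hχ : χ ∈ polynomialFunctions F) (h0 : 0 < σ (φ 0)) (h0' : 0 < σ (ψ 0)) {b : F}
    (hb : χ b ≠ 0) : ∃ t, 0 < σ (φ t) ∧ 0 < σ (ψ t) ∧ χ t ≠ 0 := by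
  classical
  obtain ⟨p, hp⟩ := mem_polynomialFunctions.mp hφ
  obtain ⟨q, hq⟩ := mem_polynomialFunctions.mp hψ
  obtain ⟨k, hk⟩ := mem_polynomialFunctions.mp hχ
  have ev : ∀ (f : Polynomial F) (s : ℝ),
      σ (f.eval (σ.symm s)) = (f.map (σ : F →+* ℝ)).eval s := by
    intro f s
    have := Polynomial.eval_map_apply (f := (σ : F →+* ℝ)) (p := f) (σ.symm s)
    simpa using this.symm
  have hopen : {s : ℝ | 0 < (p.map (σ : F →+* ℝ)).eval s ∧
      0 < (q.map (σ : F →+* ℝ)).eval s} ∈ nhds (0 : ℝ) := by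
    refine IsOpen.mem_nhds ?_ ⟨?_, ?_⟩
    · exact (isOpen_lt continuous_const (Polynomial.continuous _)).inter
        (isOpen_lt continuous_const (Polynomial.continuous _))
    · rw [← ev, map_zero, ← hp]
      exact h0
    · rw [← ev, map_zero, ← hq]
      exact h0'
  have hk0 : k ≠ 0 := by
    rintro rfl
    exact hb (by rw [hk, Polynomial.eval_zero])
  obtain ⟨s, ⟨hs, hs'⟩, hsk⟩ := (infinite_of_mem_nhds (0 : ℝ) hopen).exists_notMem_finset
    (k.roots.toFinset.image σ)
  refine ⟨σ.symm s, ?_, ?_, fun h => hsk ?_⟩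
  · rw [hp, ev]
    exact hs
  · rw [hq, ev]
    exact hs'
  · refine Finset.mem_image.mpr ⟨σ.symm s, ?_, σ.apply_symm_apply s⟩
    rw [Multiset.mem_toFinset, Polynomial.mem_roots hk0, Polynomial.IsRoot, ← hk, h]

/-- Over the reals, the ratio of the discriminant to the square of the trace takes every value
on the image. The form `disc - c tr²` is positive at a multiple of `h` and negative at a multiple
of `k`. On a path in general position between them that changes one variable at a time, it changes
sign in some single variable, where it is an indefinite binary quadratic form. -/
lemma IsConjEquivariant.exists_disc_eq_mul_trace_sq_of_real (σ : F ≃+* ℝ)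
    (hG : IsConjEquivariant G) {m m' : ι → Matrix (Fin 2) (Fin 2) F}
    (hm : ¬ IsScalarMatrix (G m)) (hm' : (G m').trace ≠ 0) (c : F) :
    ∃ A ∈ Set.range G, ¬ IsScalarMatrix A ∧ A.trace ≠ 0 ∧ disc A = c * A.trace ^ 2 := by
  classical
  have : Infinite F := Infinite.of_injective σ.symm σ.symm.injective
  have h2 : (2 : F) ≠ 0 := fun h => two_ne_zero (α := ℝ) (by
    have := congrArg σ h
    rwa [map_ofNat, map_zero] at this)
  obtain ⟨r, α, hα, hr⟩ := hG.exists_apply_eq_smul_h h2 hm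
  obtain ⟨r', β, hβ, hr'⟩ := hG.exists_apply_eq_smul_k h2 hm
  set u : ι → Matrix (Fin 2) (Fin 2) F := fun v => quaternionUnit (r v) with hu
  set u' : ι → Matrix (Fin 2) (Fin 2) F := fun v => quaternionUnit (r' v) with hu'
  have hpos : 0 < σ (discSub c (G u)) := by
    have : discSub c (G u) = (2 * α) ^ 2 := by
      rw [hr]
      simp [discSub, disc, quaternionUnit, Matrix.trace_fin_two]
      ring
    have h0 : σ (2 * α) ≠ 0 := (map_ne_zero σ).mpr (mul_ne_zero h2 hα)
    rw [this, map_pow]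
    positivity
  have hneg : 0 < σ (-discSub c (G u')) := by
    have : -discSub c (G u') = (2 * β) ^ 2 := by
      rw [hr']
      simp [discSub, disc, quaternionUnit, Matrix.trace_fin_two]
      ring
    have h0 : σ (2 * β) ≠ 0 := (map_ne_zero σ).mpr (mul_ne_zero h2 hβ)
    rw [this, map_pow]
    positivity
  obtain ⟨b, hb, hb'⟩ : ∃ b, discSub c (G b) ≠ 0 ∧ (G b).trace ≠ 0 := by
    obtain ⟨t, ht, ht'⟩ := exists_ne_zero_and_ne_zero
      (discSub_mem_polynomialFunctions G c u (m' - u))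
      (trace_mem_polynomialFunctions G u (m' - u)) (a := 0) (b := 1)
      (fun h => hpos.ne' (by simpa using h)) (by simpa using hm')
    exact ⟨_, ht, ht'⟩
  -- Both ends of the path are moved towards `b`; at `b` itself nothing degenerates.
  have hχ : (∏ s : Finset ι, fun t : F =>
      (G (s.piecewise u' u + t • (b - s.piecewise u' u))).trace *
        discSub c (G (s.piecewise u' u + t • (b - s.piecewise u' u)))) ∈
      polynomialFunctions F :=
    prod_mem fun s _ => mul_mem (trace_mem_polynomialFunctions G _ _)
      (discSub_mem_polynomialFunctions G c _ _)
  obtain ⟨t, ht, ht', hχt⟩ := exists_pos_and_pos_and_ne_zero σ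
    (discSub_mem_polynomialFunctions G c u (b - u))
    (neg_mem (discSub_mem_polynomialFunctions G c u' (b - u'))) hχ (by simpa using hpos)
    (by simpa using hneg) (b := 1) (by
      rw [Finset.prod_apply, Finset.prod_ne_zero_iff]
      intro s _
      simpa using ⟨hb', hb⟩)
  rw [Finset.prod_apply, Finset.prod_ne_zero_iff] at hχt
  rw [Pi.neg_apply, map_neg, neg_pos] at ht'
  set z := u + t • (b - u) with hz
  set z' := u' + t • (b - u') with hz'
  have hpw : ∀ s : Finset ι,
      s.piecewise u' u + t • (b - s.piecewise u' u) = s.piecewise z' z := by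
    intro s
    funext v
    by_cases hv : v ∈ s <;> simp [hz, hz', hv]
  simp only [hpw] at hχt
  obtain ⟨s, i, hs, hs'⟩ := exists_update_of_piecewise
    (p := fun w => 0 < σ (discSub c (G w))) (p' := fun w => σ (discSub c (G w)) < 0)
    ht (not_lt.mpr ht'.le) (fun s => by
      have := (map_ne_zero σ).mpr (right_ne_zero_of_mul (hχt s (Finset.mem_univ s)))
      exact this.lt_or_gt.symm)
  have htr := left_ne_zero_of_mul (hχt s (Finset.mem_univ s))
  set w := s.piecewise z' z with hw
  set X := G w with hX
  set Y := G (Function.update w i (z' i)) with hY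
  set D := (polarDisc X Y - c * (X.trace * Y.trace)) ^ 2 - discSub c X * discSub c Y with hD
  have hDpos : 0 < σ D := by
    rw [hD, map_sub, map_pow, map_mul]
    have := mul_neg_of_pos_of_neg hs hs'
    have := sq_nonneg (σ (polarDisc X Y - c * (X.trace * Y.trace)))
    linarith
  obtain ⟨a, ha, hat, hans⟩ := exists_discSub_add_smul_eq_zero (δ := σ.symm (Real.sqrt (σ D))) h2
    (by rw [← map_mul, Real.mul_self_sqrt hDpos.le, σ.symm_apply_apply])
    ((map_ne_zero σ.symm).mpr (Real.sqrt_pos.mpr hDpos).ne')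
    (fun h => hs'.ne (by rw [h, map_zero])) htr
  refine ⟨X + a • Y, ⟨Function.update w i (w i + a • z' i), ?_⟩, hans, hat, sub_eq_zero.mp ha⟩
  rw [G.map_update_add, G.map_update_smul, Function.update_eq_self]

end Real

/-! ### Images of equivariant multilinear maps -/

section Images

variable {F : Type*} [Field F] {ι : Type*} [Fintype ι] [Nonempty ι]
  {G : MultilinearMap F (fun _ : ι => Matrix (Fin 2) (Fin 2) F) (Matrix (Fin 2) (Fin 2) F)}

lemma IsQuadraticallyClosed.infinite (h2 : (2 : F) ≠ 0) (hsq : IsQuadraticallyClosed F) :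
    Infinite F := by
  by_contra hfin
  rw [not_infinite_iff_finite] at hfin
  -- Squaring would be a bijection of a finite field, but it identifies `1` and `-1`.
  have hinj : Function.Injective fun x : F => x * x :=
    Finite.injective_iff_surjective.mpr fun a => (hsq a).imp fun _ h => h.symm
  have h : (1 : F) = -1 := hinj (by simp)
  exact h2 (by linear_combination h)

/-- An equivariant multilinear map with a value that is not scalar takes every trace zero
matrix as a value. A trace zero matrix is determined up to conjugacy by its determinant, and
multiples of `h`, `k` and `E₁₂` realize all determinants. -/
lemma IsConjEquivariant.mem_range_of_trace_eq_zero [Infinite F] (h2 : (2 : F) ≠ 0)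
    (hsq : ∀ a : F, IsSquare a ∨ IsSquare (-a)) (hG : IsConjEquivariant G)
    {m : ι → Matrix (Fin 2) (Fin 2) F} (hm : ¬ IsScalarMatrix (G m))
    {T : Matrix (Fin 2) (Fin 2) F} (hT : T.trace = 0) : T ∈ Set.range G := by
  by_cases hTs : IsScalarMatrix T
  · have h0 : T = (0 : F) • G m := by
      rw [zero_smul]
      exact hTs.eq_of_trace_eq h2 (by simp [IsScalarMatrix]) (by simpa using hT)
    exact h0 ▸ smul_mem_range ⟨m, rfl⟩ 0
  by_cases hd : T.det = 0
  · obtain ⟨α, hα, hmem⟩ := hG.exists_smul_matrixUnit_mem_range h2 hm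
    refine hG.mem_range_of_trace_eq_of_det_eq hmem (by simp [IsScalarMatrix, hα]) hTs ?_ ?_
    · simp [hT, Matrix.trace_fin_two]
    · simp [hd, Matrix.det_fin_two]
  · have key : ∀ (r : ι → Fin 4) (d : Fin 4) (α s : F), α ≠ 0 →
        (G fun v => quaternionUnit (r v)) = α • quaternionUnit d →
        s • quaternionUnit d ∈ Set.range G := by
      intro r d α s hα hr
      have := smul_mem_range (G := G) ⟨_, hr⟩ (s / α)
      rwa [smul_smul, div_mul_cancel₀ _ hα] at this
    rcases hsq T.det with ⟨s, hs⟩ | ⟨s, hs⟩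
    · obtain ⟨r, α, hα, hr⟩ := hG.exists_apply_eq_smul_k h2 hm
      have hs0 : s ≠ 0 := fun h => hd (by rw [hs, h, mul_zero])
      refine hG.mem_range_of_trace_eq_of_det_eq (key r 3 α s hα hr) ?_ hTs ?_ ?_
      · simp [IsScalarMatrix, quaternionUnit, hs0]
      · simp [hT, Matrix.trace_fin_two, quaternionUnit]
      · simp [hs, Matrix.det_fin_two, quaternionUnit]
    · obtain ⟨r, α, hα, hr⟩ := hG.exists_apply_eq_smul_h h2 hm
      have hs0 : s ≠ 0 := fun h => hd (by rw [← neg_eq_zero, hs, h, mul_zero])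
      have hss : s ≠ -s := fun h =>
        mul_ne_zero h2 hs0 (by linear_combination h)
      refine hG.mem_range_of_trace_eq_of_det_eq (key r 1 α s hα hr) ?_ hTs ?_ ?_
      · simp [IsScalarMatrix, quaternionUnit, hss]
      · simp [hT, Matrix.trace_fin_two, quaternionUnit]
      · simp [← hs, Matrix.det_fin_two, quaternionUnit]

/-- The image of an equivariant multilinear map on `M₂(F)` is one of `0`, `F`, `sl₂(F)` and
`M₂(F)`. -/
theorem IsConjEquivariant.range_eq (h2 : (2 : F) ≠ 0)
    (hF : IsQuadraticallyClosed F ∨ Nonempty (F ≃+* ℝ)) (hG : IsConjEquivariant G) :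
    Set.range G = {0} ∨
    Set.range G = Set.range (algebraMap F (Matrix (Fin 2) (Fin 2) F)) ∨
    Set.range G = (LieAlgebra.SpecialLinear.sl (Fin 2) F : Set (Matrix (Fin 2) (Fin 2) F)) ∨
    Set.range G = Set.univ := by
  have hinf : Infinite F := hF.elim (·.infinite h2) fun ⟨σ⟩ =>
    Infinite.of_injective σ.symm σ.symm.injective
  have hsq : ∀ a : F, IsSquare a ∨ IsSquare (-a) := by
    intro a
    rcases hF with hF | ⟨⟨σ⟩⟩
    · exact Or.inl (hF a)
    · have lift : ∀ x : F, 0 ≤ σ x → IsSquare x := fun x hx =>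
        ⟨σ.symm (Real.sqrt (σ x)), by
          rw [← map_mul, Real.mul_self_sqrt hx, σ.symm_apply_apply]⟩
      exact (le_total 0 (σ a)).imp (lift a) fun h => lift (-a) (by rwa [map_neg, neg_nonneg])
  have smul_mem : ∀ {A : Matrix (Fin 2) (Fin 2) F} (c : F), A ∈ Set.range G →
      c • A ∈ Set.range G := fun c hA => smul_mem_range hA c
  by_cases hscalar : ∀ m, IsScalarMatrix (G m)
  · by_cases hzero : ∀ m, G m = 0
    · left
      ext A
      constructor
      · rintro ⟨m, rfl⟩
        exact hzero m
      · rintro rfl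
        exact ⟨0, hzero 0⟩
    · right; left
      push Not at hzero
      obtain ⟨m, hm⟩ := hzero
      obtain ⟨a, ha⟩ := (isScalarMatrix_iff_mem_range _).mp (hscalar m)
      have ha0 : a ≠ 0 := fun h => hm (by rw [← ha, h, map_zero])
      ext A
      constructor
      · rintro ⟨m', rfl⟩
        exact (isScalarMatrix_iff_mem_range _).mp (hscalar m')
      · rintro ⟨c, rfl⟩
        have := smul_mem (c / a) ⟨m, rfl⟩
        rwa [← ha, Algebra.smul_def, ← map_mul, div_mul_cancel₀ _ ha0] at this
  · push Not at hscalar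
    obtain ⟨m, hm⟩ := hscalar
    right; right
    by_cases htrace : ∀ m, (G m).trace = 0
    · left
      ext A
      change _ ↔ A.trace = 0
      constructor
      · rintro ⟨m', rfl⟩
        exact htrace m'
      · intro hA
        exact hG.mem_range_of_trace_eq_zero h2 hsq hm hA
    · right
      push Not at htrace
      obtain ⟨m', hm'⟩ := htrace
      refine Set.eq_univ_of_forall fun T => ?_
      by_cases hT : T.trace = 0
      · exact hG.mem_range_of_trace_eq_zero h2 hsq hm hT
      by_cases hTs : IsScalarMatrix T
      · obtain ⟨r, α, hα, hr⟩ := hG.exists_apply_eq_smul_one h2 hm'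
        have := smul_mem (T 0 0 / α) ⟨_, hr⟩
        rw [smul_smul, div_mul_cancel₀ _ hα] at this
        convert this using 1
        obtain ⟨h01, h10, h11⟩ := hTs
        ext i j
        fin_cases i <;> fin_cases j <;> simp [quaternionUnit, h01, h10, h11]
      · obtain ⟨A, hA, hAs, hAt, hAd⟩ : ∃ A ∈ Set.range G, ¬ IsScalarMatrix A ∧ A.trace ≠ 0 ∧
            disc A = disc T / T.trace ^ 2 * A.trace ^ 2 := by
          rcases hF with hF | ⟨⟨σ⟩⟩
          · exact hG.exists_disc_eq_mul_trace_sq_of_isQuadraticallyClosed h2 hF hm hm' _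
          · exact hG.exists_disc_eq_mul_trace_sq_of_real σ hm hm' _
        -- A multiple of `A` has the trace and the discriminant of `T`.
        have hc : T.trace / A.trace ≠ 0 := div_ne_zero hT hAt
        have htr : ((T.trace / A.trace) • A).trace = T.trace := by
          rw [Matrix.trace_smul, smul_eq_mul, div_mul_cancel₀ _ hAt]
        have hdisc : disc ((T.trace / A.trace) • A) = disc T := by
          rw [disc_smul, hAd]
          field_simp
        refine hG.mem_range_of_trace_eq_of_det_eq (smul_mem _ hA)
          (by rwa [isScalarMatrix_smul_iff hc]) hTs htr ?_
        rw [disc_eq_trace_sq_sub, disc_eq_trace_sq_sub, htr] at hdisc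
        exact mul_left_cancel₀ (mul_ne_zero h2 h2) (by linear_combination -hdisc)

end Images

/-! ### The multilinear map of a multilinear `*`-polynomial -/

section Polynomials

variable {F : Type*} [Field F] {k l : ℕ}

/-- The projection of `M₂(F)` to the space over which a variable ranges: the symmetric elements of
the symplectic involution are the scalars, the skew-symmetric ones the matrices of trace zero. -/
def variableProj (F : Type*) [Field F] (k l : ℕ) :
    Fin k ⊕ Fin l → Matrix (Fin 2) (Fin 2) F →ₗ[F] Matrix (Fin 2) (Fin 2) F :=
  Sum.elim
    (fun _ => (2 : F)⁻¹ • (Matrix.traceLinearMap (Fin 2) F F).smulRight 1)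
    (fun _ => LinearMap.id - (2 : F)⁻¹ • (Matrix.traceLinearMap (Fin 2) F F).smulRight 1)

lemma variableProj_inl (i : Fin k) (A : Matrix (Fin 2) (Fin 2) F) :
    variableProj F k l (Sum.inl i) A = (2 : F)⁻¹ • A.trace • 1 := rfl

lemma variableProj_inr (j : Fin l) (A : Matrix (Fin 2) (Fin 2) F) :
    variableProj F k l (Sum.inr j) A = A - (2 : F)⁻¹ • A.trace • 1 := rfl

lemma variableProj_inl_mem (i : Fin k) (A : Matrix (Fin 2) (Fin 2) F) :
    variableProj F k l (Sum.inl i) A ∈ (symplectic F).symm := by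
  change (symplectic F).toLin _ = _
  rw [variableProj_inl]
  ext a b
  fin_cases a <;> fin_cases b <;> simp [symplectic]

lemma variableProj_inr_mem (h2 : (2 : F) ≠ 0) (j : Fin l) (A : Matrix (Fin 2) (Fin 2) F) :
    variableProj F k l (Sum.inr j) A ∈ (symplectic F).skew := by
  change (symplectic F).toLin _ = _
  rw [variableProj_inr]
  ext a b
  fin_cases a <;> fin_cases b <;> simp [symplectic, Matrix.trace_fin_two] <;> field_simp <;> ring

lemma variableProj_inl_eq_self (h2 : (2 : F) ≠ 0) (i : Fin k) {A : Matrix (Fin 2) (Fin 2) F}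
    (hA : A ∈ (symplectic F).symm) : variableProj F k l (Sum.inl i) A = A := by
  have hA' : !![A 1 1, -A 0 1; -A 1 0, A 0 0] = A := hA
  have e00 : A 1 1 = A 0 0 := congrFun (congrFun hA' 0) 0
  have e01 : -A 0 1 = A 0 1 := congrFun (congrFun hA' 0) 1
  have e10 : -A 1 0 = A 1 0 := congrFun (congrFun hA' 1) 0
  have h01 : A 0 1 = 0 := mul_left_cancel₀ h2 (by linear_combination -e01)
  have h10 : A 1 0 = 0 := mul_left_cancel₀ h2 (by linear_combination -e10)
  rw [variableProj_inl]
  ext a b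
  fin_cases a <;> fin_cases b <;> simp [Matrix.trace_fin_two, h01, h10, e00] <;> field_simp <;> ring

lemma variableProj_inr_eq_self (j : Fin l) {A : Matrix (Fin 2) (Fin 2) F}
    (hA : A ∈ (symplectic F).skew) : variableProj F k l (Sum.inr j) A = A := by
  have hA' : !![A 1 1, -A 0 1; -A 1 0, A 0 0] = -A := hA
  have e00 : A 1 1 = -A 0 0 := congrFun (congrFun hA' 0) 0
  rw [variableProj_inr, Matrix.trace_fin_two, e00]
  simp

lemma variableProj_conj {P Q : Matrix (Fin 2) (Fin 2) F} (hPQ : P * Q = 1) (v : Fin k ⊕ Fin l)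
    (A : Matrix (Fin 2) (Fin 2) F) :
    variableProj F k l v (P * A * Q) = P * variableProj F k l v A * Q := by
  have htr : (P * A * Q).trace = A.trace := by
    rw [Matrix.trace_mul_comm, ← Matrix.mul_assoc, mul_eq_one_comm.mp hPQ, Matrix.one_mul]
  rcases v with i | j
  · rw [variableProj_inl, variableProj_inl, htr]
    simp [hPQ]
  · rw [variableProj_inr, variableProj_inr, htr]
    simp [hPQ, mul_sub, sub_mul]

/-- The Boolean equality of a sum type by which occurrences of a variable are counted is
equality. -/
lemma lawfulBEq_sum : LawfulBEq (Fin k ⊕ Fin l) where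
  eq_of_beq {x y} h := by
    rcases x with x | x <;> rcases y with y | y
    · exact congrArg Sum.inl (eq_of_beq (a := x) (b := y) h)
    · exact absurd h Bool.false_ne_true
    · exact absurd h Bool.false_ne_true
    · exact congrArg Sum.inr (eq_of_beq (a := x) (b := y) h)
  rfl {x} := by
    rcases x with x | x <;> exact beq_self_eq_true x

/-- The value of a word is additive and homogeneous in a letter that occurs exactly once. -/
lemma exists_prod_map_update_eq {X A : Type*} [DecidableEq X] [Monoid A] {w : List X} {v : X}
    (hw : w.count v = 1) (m : X → A) :
    ∃ p q : A, ∀ a, (w.map (Function.update m v a)).prod = p * a * q := by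
  obtain ⟨s, t, rfl⟩ := List.append_of_mem (List.count_pos_iff.mp (by omega : 0 < w.count v))
  simp only [List.count_append, List.count_cons_self] at hw
  have fix : ∀ (u : List X) (a : A), u.count v = 0 → u.map (Function.update m v a) = u.map m :=
    fun u a hu => List.map_congr_left fun x hx =>
      Function.update_of_ne (fun h : x = v => List.count_eq_zero.mp hu (h ▸ hx)) _ _
  refine ⟨(s.map m).prod, (t.map m).prod, fun a => ?_⟩
  rw [List.map_append, List.map_cons, List.prod_append, List.prod_cons, fix s a (by omega),
    fix t a (by omega), Function.update_self, mul_assoc]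

lemma lift_eq_sum {A X : Type*} [Ring A] [Algebra F A] (f : FreeAlgebra F X) (m : X → A) :
    FreeAlgebra.lift F m f =
      ∑ w ∈ (FreeAlgebra.equivMonoidAlgebraFreeMonoid f :
        MonoidAlgebra F (FreeMonoid X)).coeff.support,
        (FreeAlgebra.equivMonoidAlgebraFreeMonoid f).coeff w •
          ((FreeMonoid.toList w).map m).prod := by
  have h : FreeAlgebra.lift F m = (MonoidAlgebra.lift F A (FreeMonoid X)
      (FreeMonoid.lift m)).comp FreeAlgebra.equivMonoidAlgebraFreeMonoid.toAlgHom := by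
    refine FreeAlgebra.hom_ext (funext fun x => ?_)
    simp [FreeAlgebra.equivMonoidAlgebraFreeMonoid]
  rw [h]
  simp [MonoidAlgebra.lift_apply, Finsupp.sum, FreeMonoid.lift_apply]

/-- The multilinear map on all of `M₂(F)` whose values are those of a multilinear `*`-polynomial:
each argument is first projected to the space over which its variable ranges. -/
noncomputable def evalMultilinear (f : Polynomials F k l) (hf : IsMultilinear f) :
    MultilinearMap F (fun _ : Fin k ⊕ Fin l => Matrix (Fin 2) (Fin 2) F)
      (Matrix (Fin 2) (Fin 2) F) where
  toFun m := FreeAlgebra.lift F (fun v => variableProj F k l v (m v)) f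
  map_update_add' := by
    intro _ m v x y
    have upd : ∀ x, (fun u => variableProj F k l u (Function.update m v x u)) =
        Function.update (fun u => variableProj F k l u (m u)) v (variableProj F k l v x) :=
      fun x => funext fun u => Function.apply_update (fun u => variableProj F k l u) m v x u
    simp only [upd, lift_eq_sum, ← Finset.sum_add_distrib, ← smul_add]
    refine Finset.sum_congr rfl fun w hw => ?_
    obtain ⟨p, q, hpq⟩ := exists_prod_map_update_eq (v := v)
      (by
        convert hf w hw v using 2
        have := lawfulBEq_sum (k := k) (l := l)
        exact lawful_beq_subsingleton _ _) (fun u => variableProj F k l u (m u))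
    rw [hpq, hpq, hpq, map_add, mul_add, add_mul]
  map_update_smul' := by
    intro _ m v c x
    have upd : ∀ x, (fun u => variableProj F k l u (Function.update m v x u)) =
        Function.update (fun u => variableProj F k l u (m u)) v (variableProj F k l v x) :=
      fun x => funext fun u => Function.apply_update (fun u => variableProj F k l u) m v x u
    simp only [upd, lift_eq_sum, Finset.smul_sum]
    refine Finset.sum_congr rfl fun w hw => ?_
    obtain ⟨p, q, hpq⟩ := exists_prod_map_update_eq (v := v)
      (by
        convert hf w hw v using 2
        have := lawfulBEq_sum (k := k) (l := l)
        exact lawful_beq_subsingleton _ _) (fun u => variableProj F k l u (m u))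
    rw [hpq, hpq, map_smul, mul_smul_comm, smul_mul_assoc, smul_comm]

lemma evalMultilinear_apply (f : Polynomials F k l) (hf : IsMultilinear f)
    (m : Fin k ⊕ Fin l → Matrix (Fin 2) (Fin 2) F) :
    evalMultilinear f hf m = FreeAlgebra.lift F (fun v => variableProj F k l v (m v)) f := rfl

lemma isConjEquivariant_evalMultilinear (f : Polynomials F k l) (hf : IsMultilinear f) :
    IsConjEquivariant (evalMultilinear f hf) := by
  intro P Q hPQ m
  let conj : Matrix (Fin 2) (Fin 2) F →ₐ[F] Matrix (Fin 2) (Fin 2) F :=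
    AlgHom.ofLinearMap
      ((LinearMap.mulRight F Q).comp (LinearMap.mulLeft F P)) (by simp [hPQ]) (fun A B => by
        simp only [LinearMap.comp_apply, LinearMap.mulLeft_apply, LinearMap.mulRight_apply]
        calc P * (A * B) * Q = P * A * 1 * B * Q := by noncomm_ring
          _ = P * A * Q * (P * B * Q) := by
            rw [← mul_eq_one_comm.mp hPQ]
            noncomm_ring)
  have h : FreeAlgebra.lift F (fun v => variableProj F k l v (P * m v * Q)) =
      conj.comp (FreeAlgebra.lift F fun v => variableProj F k l v (m v)) := by
    refine FreeAlgebra.hom_ext (funext fun v => ?_)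
    simp [variableProj_conj hPQ, conj]
  rw [evalMultilinear_apply, evalMultilinear_apply, h]
  rfl

lemma image_eq_range_evalMultilinear (h2 : (2 : F) ≠ 0) (f : Polynomials F k l)
    (hf : IsMultilinear f) : image (symplectic F) f = Set.range (evalMultilinear f hf) := by
  ext A
  constructor
  · rintro ⟨p, rfl⟩
    refine ⟨Sum.elim (fun i => (p.1 i : Matrix (Fin 2) (Fin 2) F)) fun j => p.2 j, ?_⟩
    rw [evalMultilinear_apply]
    congr 2
    funext v
    rcases v with i | j
    · exact variableProj_inl_eq_self h2 i (p.1 i).2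
    · exact variableProj_inr_eq_self j (p.2 j).2
  · rintro ⟨m, rfl⟩
    refine ⟨(fun i => ⟨_, variableProj_inl_mem (l := l) i (m (Sum.inl i))⟩,
      fun j => ⟨_, variableProj_inr_mem (k := k) h2 j (m (Sum.inr j))⟩), ?_⟩
    rw [evalMultilinear_apply]
    change FreeAlgebra.lift F _ f = _
    congr 2
    funext v
    rcases v with i | j <;> rfl

end Polynomials

end StarPoly

theorem mainTheorem2 {F : Type*} [Field F] (h2 : (2 : F) ≠ 0)
    (hF : StarPoly.IsQuadraticallyClosed F ∨ Nonempty (F ≃+* ℝ))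
    {k l : ℕ} (hkl : 1 ≤ k + l)
    (f : StarPoly.Polynomials F k l) (hf : StarPoly.IsMultilinear f) :
    StarPoly.image (StarPoly.symplectic F) f = {0} ∨
    StarPoly.image (StarPoly.symplectic F) f =
      Set.range (algebraMap F (Matrix (Fin 2) (Fin 2) F)) ∨
    StarPoly.image (StarPoly.symplectic F) f =
      (LieAlgebra.SpecialLinear.sl (Fin 2) F : Set (Matrix (Fin 2) (Fin 2) F)) ∨
    StarPoly.image (StarPoly.symplectic F) f = Set.univ := by
  have : Nonempty (Fin k ⊕ Fin l) := by
    rw [← Fintype.card_pos_iff, Fintype.card_sum, Fintype.card_fin, Fintype.card_fin]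
    exact hkl
  rw [StarPoly.image_eq_range_evalMultilinear h2 f hf]
  exact (StarPoly.isConjEquivariant_evalMultilinear f hf).range_eq h2 hF
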